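/- **Theorem (bandit lower bound).** Consider online linear optimization on the hypercube $\{0,1\}^n$ over $T$ rounds with bandit feedback. In each round $t$ the learner plays $X_t\in\{0,1\}^n$, chosen as a (measurable) function of its internal randomization and of the scalar losses $X_s^\top l_s$, $s<t$, that it incurred in the earlier rounds. Simultaneously, an adversary chooses a loss vector $l_t\in\mathbb{R}^n$ with $\|l_t\|_\infty\le 1$, possibly depending on its own randomization (independent of that of the learner) and on $X_s$, $s<t$. The regret is $$R_T=\sum_{t=1}^T X_t^\top l_t-\min_{X\in\{0,1\}^n}\sum_{t=1}^T X^\top l_t ,$$ and $\mathbb{E}[R_T]$ is its expectation over the randomizations of the learner and of the adversary. For any learner there is an adversary such that $\mathbb{E}[R_T]=\Omega(n^{3/2}\sqrt{T})$, and this adversary can be taken oblivious (its losses do not depend on the learner's actions). Precisely: for every $\kappa>0$ there is a constant $c>0$, depending only on $\kappa$, such that for all $n$ and $T$ with $T\ge\kappa n$ and for every randomized learner (which may depend on $n$ and $T$) there is an oblivious adversary, with losses satisfying $\|l_t\|_\infty\le1$, for which $$\mathbb{E}[R_T]\ \ge\ c\,n^{3/2}\sqrt{T}.$$ -/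

import Mathlib

open MeasureTheory

namespace HypercubeBandit

/-- The decision set `{0,1}^n`; `X i = true` means that the `i`-th coordinate of `X` is `1`. -/
abbrev Vertex (n : ℕ) : Type := Fin n → Bool

/-- The scalar loss `Xᵀ l` of playing the vertex `X` against the loss vector `l`. -/
def cost {n : ℕ} (X : Vertex n) (l : Fin n → ℝ) : ℝ :=
  ∑ i, if X i then l i else 0

/-- A randomized learner in the bandit setting. Its internal randomization is a point `ω` of `Ω`
(drawn once, before the game). In round `t` (rounds are numbered `0, 1, 2, …`) it plays
`act t ω y`, where `y 0, …, y (t - 1)` are the scalar losses incurred in the earlier rounds;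
nothing else about the loss vectors is revealed to it. Its own past actions are functions of
`ω` and of `y`, so that it may use them as well. -/
structure Learner (n : ℕ) (Ω : Type*) [MeasurableSpace Ω] where
  act : (t : ℕ) → Ω → (Fin t → ℝ) → Vertex n
  measurable_act : ∀ t, Measurable fun p : Ω × (Fin t → ℝ) => act t p.1 p.2

/-- A randomized, possibly adaptive adversary with `L_∞` losses. Its own randomization is a point
`ω'` of `Ω'`. In round `t` it chooses the loss vector `loss t ω' x`, where `x 0, …, x (t - 1)`
are the actions of the learner in the earlier rounds; it does not see the internal randomization of
the learner or the action of the current round. The norm on `Fin n → ℝ` is the maximum norm. -/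
structure Adversary (n : ℕ) (Ω' : Type*) [MeasurableSpace Ω'] where
  loss : (t : ℕ) → Ω' → (Fin t → Vertex n) → Fin n → ℝ
  measurable_loss : ∀ t, Measurable fun p : Ω' × (Fin t → Vertex n) => loss t p.1 p.2
  norm_loss_le : ∀ t ω' x, ‖loss t ω' x‖ ≤ 1

/-- An adversary is oblivious if its losses do not depend on the actions of the learner. -/
def Adversary.IsOblivious {n : ℕ} {Ω' : Type*} [MeasurableSpace Ω'] (A : Adversary n Ω') : Prop :=
  ∀ t ω' x x', A.loss t ω' x = A.loss t ω' x'

section Game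

variable {n : ℕ} {Ω Ω' : Type*} [MeasurableSpace Ω] [MeasurableSpace Ω']

/-- The pair `(X_t, l_t)` of the action and the loss vector of round `t`, when the learner `L` with
internal randomization `ω` plays against the adversary `A` with randomization `ω'`. -/
def round (L : Learner n Ω) (A : Adversary n Ω') (ω : Ω) (ω' : Ω') (t : ℕ) :
    Vertex n × (Fin n → ℝ) :=
  (L.act t ω fun s : Fin t => cost (round L A ω ω' s).1 (round L A ω ω' s).2,
    A.loss t ω' fun s : Fin t => (round L A ω ω' s).1)
termination_by t
decreasing_by all_goals exact s.isLt

/-- The regret `R_T = ∑_t X_tᵀ l_t - min_X ∑_t Xᵀ l_t` after `T` rounds. -/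
def regret (L : Learner n Ω) (A : Adversary n Ω') (T : ℕ) (ω : Ω) (ω' : Ω') : ℝ :=
  (∑ t ∈ Finset.range T, cost (round L A ω ω' t).1 (round L A ω ω' t).2) -
    Finset.univ.inf' Finset.univ_nonempty
      (fun X : Vertex n => ∑ t ∈ Finset.range T, cost X (round L A ω ω' t).2)

/-- The expected regret after `T` rounds; the internal randomization of the learner, with law `P`,
and the randomization of the adversary, with law `Q`, are independent. -/
noncomputable def expectedRegret (P : Measure Ω) (L : Learner n Ω) (Q : Measure Ω')
    (A : Adversary n Ω') (T : ℕ) : ℝ :=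
  ∫ p, regret L A T p.1 p.2 ∂(P.prod Q)

end Game

end HypercubeBandit

/-!
The adversary hides a sign vector `θ` in the losses: every coordinate of the loss vector of a round
is a small bias `± m / (4 M)`, with sign `θ i`, plus a noise term common to all coordinates. The
best vertex in hindsight is then at least as good as the complement of `θ`, so that the learner
loses the bias for each round and each coordinate `i` in which its action agrees with `θ i`
(`sum_amp_sq_mul_numErr_le_sum_regret`).

An action with `k` ones reveals `k` times the noise plus the bias times a sum of `k` signs. Changing
one of these signs translates the observation by the fraction `1 / k` of twice the bias, measured in
units of the scale `k` of the noise. Since the amplitude (the square root of the law) of the noise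
is a tent function, hence Lipschitz, the squared Hellinger distance of the two laws is of order
`(bias / k) ^ 2` (`one_sub_le_sum_noiseAmp_mul`). Summed over the `k` coordinates that are played,
this is at most of order `bias ^ 2`, whatever `k` is (`sum_flipInfo_le`). The Hellinger affinity of
the laws of whole histories loses in each round at most the expected distance of the conditional
laws (`one_sub_le_sum_amp_mul_amp`). Hence `T` rounds yield information of order `T * bias ^ 2` to
be shared by `n` coordinates; with a bias of order `√(n / T)`, a two-point argument shows that, on
average over the signs, a constant fraction of the coordinates is wrong in every round
(`le_sum_amp_sq_mul_numErr`). The regret is then of order `n * T * √(n / T)`, first on average over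
the signs and hence for some choice of them (`exists_le_expectedRegret`).

The noise takes finitely many values, so that all the laws but that of the learner's randomization
are finite sums. The bias is `m = n!` steps of the lattice of noise values, so that the translations
by fractions `m / k` with `k ≤ n` are again lattice steps. Noise values are represented in the
cyclic group of order `4 M`, in which translation is a bijection; the noise has absolute value less
than `M` and the translations are at most `M`, so that nothing wraps around
(`cost_lossVec_eq_shift`).
-/

namespace HypercubeBandit

/-! ### Likelihoods of adaptively generated histories -/

section Likelihood

variable {A : Type*}

theorem sum_snoc [Fintype A] (t : ℕ) (f : (Fin (t + 1) → A) → ℝ) :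
    ∑ o, f o = ∑ o : Fin t → A, ∑ x, f (Fin.snoc o x) := by
  rw [← Fintype.sum_prod_type', ← (Fin.snocEquiv fun _ => A).sum_comp,
    ← (Equiv.prodComm _ _).sum_comp]
  rfl

variable [AddCommGroup A]

/-- The square root of the likelihood of a history `o` of observations, when the observation of
round `s` is the shift `a s (o 0, …, o (s - 1))` plus a noise of law `u ^ 2`. -/
def amp (u : A → ℝ) (a : (t : ℕ) → (Fin t → A) → A) : (t : ℕ) → (Fin t → A) → ℝ
  | 0, _ => 1
  | t + 1, o => amp u a t (Fin.init o) * u (o (Fin.last t) - a t (Fin.init o))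

/-- The history of the first `t` observations generated by the noise sequence `ζ`. -/
def hist (a : (t : ℕ) → (Fin t → A) → A) (ζ : ℕ → A) : (t : ℕ) → Fin t → A
  | 0 => Fin.elim0
  | t + 1 => Fin.snoc (hist a ζ t) (ζ t + a t (hist a ζ t))

theorem amp_snoc (u : A → ℝ) (a : (t : ℕ) → (Fin t → A) → A) (t : ℕ) (o : Fin t → A) (x : A) :
    amp u a (t + 1) (Fin.snoc o x) = amp u a t o * u (x - a t o) := by
  simp [amp]

theorem amp_nonneg {u : A → ℝ} (hu : ∀ x, 0 ≤ u x) (a : (t : ℕ) → (Fin t → A) → A) (t : ℕ)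
    (o : Fin t → A) : 0 ≤ amp u a t o := by
  induction t with
  | zero => simp [amp]
  | succ t ih => exact mul_nonneg (ih _) (hu _)

theorem hist_congr (a : (t : ℕ) → (Fin t → A) → A) {ζ ζ' : ℕ → A} {t : ℕ}
    (h : ∀ s < t, ζ s = ζ' s) : hist a ζ t = hist a ζ' t := by
  induction t with
  | zero => rfl
  | succ t ih =>
    rw [hist, hist, ih fun s hs => h s (hs.trans t.lt_succ_self), h t t.lt_succ_self]

variable [Fintype A]

theorem sum_amp_sq {u : A → ℝ} (hu1 : ∑ x, u x ^ 2 = 1) (a : (t : ℕ) → (Fin t → A) → A) (t : ℕ) :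
    ∑ o, amp u a t o ^ 2 = 1 := by
  induction t with
  | zero => simp [amp]
  | succ t ih =>
    rw [sum_snoc, ← ih]
    refine Finset.sum_congr rfl fun o _ => ?_
    simp_rw [amp_snoc, mul_pow, ← Finset.mul_sum]
    have h := (Equiv.subRight (a t o)).sum_comp fun x => u x ^ 2
    simp only [Equiv.subRight_apply] at h
    rw [h, hu1, mul_one]

/-- The Hellinger affinity of the laws of two adaptively generated histories decreases in each
round by at most the expected Hellinger distance of the conditional laws of the observation, because
the square root of the product of two likelihoods is at most their mean. -/
theorem one_sub_le_sum_amp_mul_amp {u : A → ℝ} (hu : ∀ x, 0 ≤ u x)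
    {a b : (t : ℕ) → (Fin t → A) → A} {δ : (t : ℕ) → (Fin t → A) → ℝ} (hδ : ∀ t o, 0 ≤ δ t o)
    (hab : ∀ t o, 1 - δ t o ≤ ∑ x, u (x - a t o) * u (x - b t o)) (t : ℕ) :
    1 - ∑ s ∈ Finset.range t, ∑ o, (amp u a s o ^ 2 + amp u b s o ^ 2) / 2 * δ s o ≤
      ∑ o, amp u a t o * amp u b t o := by
  induction t with
  | zero => simp [amp]
  | succ t ih =>
    rw [sum_snoc, Finset.sum_range_succ]
    have key : ∑ o, (amp u a t o * amp u b t o -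
        (amp u a t o ^ 2 + amp u b t o ^ 2) / 2 * δ t o) ≤
        ∑ o, ∑ x, amp u a (t + 1) (Fin.snoc o x) * amp u b (t + 1) (Fin.snoc o x) := by
      refine Finset.sum_le_sum fun o _ => ?_
      have h1 : ∑ x, amp u a (t + 1) (Fin.snoc o x) * amp u b (t + 1) (Fin.snoc o x) =
          amp u a t o * amp u b t o * ∑ x, u (x - a t o) * u (x - b t o) := by
        rw [Finset.mul_sum]
        refine Finset.sum_congr rfl fun x _ => ?_
        rw [amp_snoc, amp_snoc]; ring
      rw [h1]
      have h2 := mul_le_mul_of_nonneg_left (hab t o)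
        (mul_nonneg (amp_nonneg hu a t o) (amp_nonneg hu b t o))
      have h3 : amp u a t o * amp u b t o * δ t o ≤
          (amp u a t o ^ 2 + amp u b t o ^ 2) / 2 * δ t o :=
        mul_le_mul_of_nonneg_right (by linarith [two_mul_le_add_sq (amp u a t o) (amp u b t o)])
          (hδ t o)
      linarith
    rw [Finset.sum_sub_distrib] at key
    linarith

end Likelihood

/-! ### Independent noise -/

section Noise

variable {A : Type*}

/-- The noise sequence `z 0, …, z (T - 1)`, continued by zeros. -/
def ext [Zero A] {T : ℕ} (z : Fin T → A) (t : ℕ) : A :=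
  if h : t < T then z ⟨t, h⟩ else 0

theorem ext_of_lt [Zero A] {T : ℕ} (z : Fin T → A) {t : ℕ} (h : t < T) : ext z t = z ⟨t, h⟩ :=
  dif_pos h

theorem ext_update_of_ne [Zero A] {T : ℕ} (z : Fin T → A) {t s : ℕ} (h : t < T) (x : A)
    (hs : s ≠ t) : ext (Function.update z ⟨t, h⟩ x) s = ext z s := by
  unfold ext
  split_ifs with h'
  · rw [Function.update_of_ne]
    simpa using hs
  · rfl

/-- Independent noise: the value of one coordinate may be resampled in the expectation of a function
that sees this coordinate only through its last argument. The involution exchanging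
the coordinate with the fresh sample preserves the weights. -/
theorem sum_prod_mul_eq_resample [Fintype A] {T : ℕ} {w : A → ℝ} (hw : ∑ x, w x = 1)
    (t : Fin T) (G : (Fin T → A) → A → ℝ) (hG : ∀ z x y, G (Function.update z t y) x = G z x) :
    ∑ z, (∏ s, w (z s)) * G z (z t) = ∑ z, (∏ s, w (z s)) * ∑ x, w x * G z x := by
  have e : Function.Involutive fun p : (Fin T → A) × A => (Function.update p.1 t p.2, p.1 t) := by
    intro p
    simp
  have hprod : ∀ z : Fin T → A, ∀ x, (∏ s, w (Function.update z t x s)) * w (z t) =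
      (∏ s, w (z s)) * w x := by
    intro z x
    rw [← Finset.mul_prod_erase _ _ (Finset.mem_univ t),
      ← Finset.mul_prod_erase _ (fun s => w (z s)) (Finset.mem_univ t), Function.update_self,
      Finset.prod_congr rfl fun s hs => by rw [Function.update_of_ne (Finset.ne_of_mem_erase hs)]]
    ring
  calc ∑ z, (∏ s, w (z s)) * G z (z t)
      = ∑ z, ∑ x, (∏ s, w (z s)) * w x * G z (z t) := by
        refine Finset.sum_congr rfl fun z _ => ?_
        rw [← Finset.sum_mul, ← Finset.mul_sum, hw, mul_one]
    _ = ∑ p : (Fin T → A) × A, (∏ s, w (p.1 s)) * w p.2 * G p.1 (p.1 t) := by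
        rw [Fintype.sum_prod_type]
    _ = ∑ p : (Fin T → A) × A, (∏ s, w (p.1 s)) * w p.2 * G p.1 p.2 := by
        rw [← Equiv.sum_comp (Function.Involutive.toPerm _ e)]
        refine Finset.sum_congr rfl fun p _ => ?_
        simp only [Function.Involutive.coe_toPerm, Function.update_self, hprod, hG]
    _ = _ := by
        rw [Fintype.sum_prod_type]
        refine Finset.sum_congr rfl fun z _ => ?_
        rw [Finset.mul_sum]
        exact Finset.sum_congr rfl fun x _ => by ring

/-- Under independent noise of law `u ^ 2`, the history of observations has likelihood
`amp ^ 2`. -/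
theorem sum_prod_mul_hist [AddCommGroup A] [Fintype A] {T : ℕ} {u : A → ℝ}
    (hu1 : ∑ x, u x ^ 2 = 1) (a : (t : ℕ) → (Fin t → A) → A) {t : ℕ} (ht : t ≤ T)
    (F : (Fin t → A) → ℝ) :
    ∑ z : Fin T → A, (∏ s, u (z s) ^ 2) * F (hist a (ext z) t) = ∑ o, amp u a t o ^ 2 * F o := by
  induction t with
  | zero =>
    have h : ∀ z : Fin T → A, F (hist a (ext z) 0) = F Fin.elim0 := fun _ => rfl
    simp_rw [h, ← Finset.sum_mul]
    rw [← Fintype.prod_sum fun (_ : Fin T) x => u x ^ 2]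
    simp [hu1, amp, Subsingleton.elim (default : Fin 0 → A) Fin.elim0]
  | succ t ih =>
    have ht' : t < T := ht
    have h1 := sum_prod_mul_eq_resample (w := fun x => u x ^ 2) hu1 ⟨t, ht'⟩
      (fun z x => F (Fin.snoc (hist a (ext z) t) (x + a t (hist a (ext z) t)))) (by
        intro z x y
        have : hist a (ext (Function.update z ⟨t, ht'⟩ y)) t = hist a (ext z) t :=
          hist_congr a fun s hs => ext_update_of_ne z ht' y hs.ne
        simp only [this])
    simp only [hist, ext_of_lt _ ht']
    rw [h1, ih ht'.le fun o => ∑ x, u x ^ 2 * F (Fin.snoc o (x + a t o)), sum_snoc]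
    refine Finset.sum_congr rfl fun o _ => ?_
    rw [← (Equiv.subRight (a t o)).sum_comp, Finset.mul_sum]
    refine Finset.sum_congr rfl fun x _ => ?_
    simp only [Equiv.subRight_apply, amp_snoc, sub_add_cancel]
    ring

end Noise

/-! ### Tent-shaped noise on a cyclic group -/

section Tent

variable {M : ℕ}

/-- The tent function of radius `M` on the cyclic group of order `4 M`. -/
def tent (M : ℕ) (x : ZMod (4 * M)) : ℝ :=
  max 0 (M - |(x.valMinAbs : ℝ)|)

theorem tent_nonneg (x : ZMod (4 * M)) : 0 ≤ tent M x :=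
  le_max_left _ _

theorem abs_valMinAbs_lt_of_tent_ne_zero {x : ZMod (4 * M)} (h : tent M x ≠ 0) :
    |x.valMinAbs| < M := by
  by_contra hx
  refine h (max_eq_left ?_)
  have : (M : ℝ) ≤ |(x.valMinAbs : ℝ)| := by exact_mod_cast not_lt.1 hx
  linarith

theorem tent_neg [NeZero M] (x : ZMod (4 * M)) : tent M (-x) = tent M x := by
  have h : |(-x).valMinAbs| = |x.valMinAbs| := by
    rw [Int.abs_eq_natAbs, Int.abs_eq_natAbs, ZMod.natAbs_valMinAbs_neg]
  have h' : |((-x).valMinAbs : ℝ)| = |(x.valMinAbs : ℝ)| := by exact_mod_cast h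
  rw [tent, tent, h']

theorem valMinAbs_neg_of_abs_lt [NeZero M] {x : ZMod (4 * M)} (h : |x.valMinAbs| < M) :
    (-x).valMinAbs = -x.valMinAbs := by
  refine ZMod.valMinAbs_neg_of_ne_half fun hx => ?_
  rw [ZMod.valMinAbs_def_pos] at h
  split_ifs at h <;> rw [abs_lt] at h <;> push_cast at h <;> omega

theorem abs_valMinAbs_add_intCast_le [NeZero M] (x : ZMod (4 * M)) (d : ℤ) :
    |(x + d).valMinAbs| ≤ |x.valMinAbs| + |d| := by
  have h : (x + d).valMinAbs.natAbs ≤ (x.valMinAbs + d).natAbs := by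
    refine ZMod.natAbs_min_of_le_div_two (4 * M) _ _ ?_ (ZMod.natAbs_valMinAbs_le _)
    push_cast
    simp
  have h2 : |(x + d).valMinAbs| ≤ |x.valMinAbs + d| := by
    rw [Int.abs_eq_natAbs, Int.abs_eq_natAbs]; exact_mod_cast h
  exact h2.trans (abs_add_le _ _)

theorem abs_tent_add_intCast_sub_le [NeZero M] (x : ZMod (4 * M)) (d : ℤ) :
    |tent M (x + d) - tent M x| ≤ |(d : ℝ)| := by
  have h1 : |((x + d).valMinAbs : ℝ)| ≤ |(x.valMinAbs : ℝ)| + |(d : ℝ)| := by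
    exact_mod_cast abs_valMinAbs_add_intCast_le x d
  have h2 : |(x.valMinAbs : ℝ)| ≤ |((x + d).valMinAbs : ℝ)| + |(d : ℝ)| := by
    have h := abs_valMinAbs_add_intCast_le (x + (d : ZMod (4 * M))) (-d)
    rw [abs_neg, Int.cast_neg, add_neg_cancel_right] at h
    exact_mod_cast h
  unfold tent
  rw [max_comm, max_comm (0 : ℝ)]
  refine (abs_max_sub_max_le_abs _ _ _).trans ?_
  rw [abs_le]
  constructor <;> linarith

theorem le_sum_tent_sq [NeZero M] : (M : ℝ) ^ 3 / 3 ≤ ∑ x, tent M x ^ 2 := by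
  have h1 : ∀ k : ℕ, (k : ℝ) ^ 3 / 3 ≤ ∑ j ∈ Finset.range k, ((k : ℝ) - j) ^ 2 := by
    intro k
    induction k with
    | zero => simp
    | succ k ih =>
      rw [Finset.sum_range_succ']
      push_cast
      simp only [add_sub_add_right_eq_sub]
      nlinarith [k.cast_nonneg (α := ℝ)]
  have hv : ∀ j ∈ Finset.range M, (((j : ℕ) : ZMod (4 * M))).valMinAbs = j := by
    intro j hj
    have hj' := Finset.mem_range.1 hj
    exact ZMod.valMinAbs_natCast_of_le_half (by omega)
  have hinj : Set.InjOn (fun j : ℕ => (j : ZMod (4 * M))) (Finset.range M) := by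
    intro i hi j hj hij
    have := congrArg ZMod.valMinAbs hij
    simp only [hv i hi, hv j hj] at this
    exact_mod_cast this
  calc (M : ℝ) ^ 3 / 3 ≤ ∑ j ∈ Finset.range M, ((M : ℝ) - j) ^ 2 := h1 M
    _ = ∑ j ∈ Finset.range M, tent M (j : ZMod (4 * M)) ^ 2 := by
        refine Finset.sum_congr rfl fun j hj => ?_
        have : (j : ℝ) ≤ M := by exact_mod_cast (Finset.mem_range.1 hj).le
        rw [tent, hv j hj]
        simp [this]
    _ = ∑ x ∈ (Finset.range M).image (fun j : ℕ => (j : ZMod (4 * M))), tent M x ^ 2 := by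
        rw [Finset.sum_image hinj]
    _ ≤ _ := Finset.sum_le_sum_of_subset_of_nonneg (Finset.subset_univ _) fun _ _ _ => sq_nonneg _

/-- The amplitude of the noise: the tent function, normalized in `ℓ²`. The law of the noise is the
square of the amplitude. -/
noncomputable def noiseAmp (M : ℕ) [NeZero M] (x : ZMod (4 * M)) : ℝ :=
  tent M x / √(∑ y, tent M y ^ 2)

variable [NeZero M]

theorem sum_tent_sq_pos : 0 < ∑ x, tent M x ^ 2 := by
  have : (0 : ℝ) < M := by exact_mod_cast NeZero.pos M
  exact (by positivity : (0 : ℝ) < M ^ 3 / 3).trans_le le_sum_tent_sq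

theorem noiseAmp_nonneg (x : ZMod (4 * M)) : 0 ≤ noiseAmp M x :=
  div_nonneg (tent_nonneg x) (Real.sqrt_nonneg _)

theorem noiseAmp_neg (x : ZMod (4 * M)) : noiseAmp M (-x) = noiseAmp M x := by
  rw [noiseAmp, noiseAmp, tent_neg]

theorem sum_noiseAmp_sq : ∑ x, noiseAmp M x ^ 2 = 1 := by
  simp_rw [noiseAmp, div_pow, Real.sq_sqrt sum_tent_sq_pos.le, ← Finset.sum_div]
  exact div_self sum_tent_sq_pos.ne'

theorem abs_valMinAbs_lt_of_noiseAmp_ne_zero {x : ZMod (4 * M)} (h : noiseAmp M x ≠ 0) :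
    |x.valMinAbs| < M :=
  abs_valMinAbs_lt_of_tent_ne_zero fun hx => h (by rw [noiseAmp, hx, zero_div])

theorem sum_noiseAmp_sq_mul_valMinAbs :
    ∑ x, noiseAmp M x ^ 2 * (x.valMinAbs : ℝ) = 0 := by
  have h : ∑ x, noiseAmp M x ^ 2 * (x.valMinAbs : ℝ) =
      ∑ x, -(noiseAmp M x ^ 2 * (x.valMinAbs : ℝ)) := by
    rw [← Equiv.sum_comp (Equiv.neg _)]
    refine Finset.sum_congr rfl fun x _ => ?_
    rw [Equiv.neg_apply, noiseAmp_neg]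
    by_cases hx : noiseAmp M x = 0
    · simp [hx]
    · rw [valMinAbs_neg_of_abs_lt (abs_valMinAbs_lt_of_noiseAmp_ne_zero hx)]
      push_cast
      ring
  rw [Finset.sum_neg_distrib] at h
  linarith

/-- The affinity of two translates of the law of the noise. The tent is Lipschitz, so that the
affinity falls short of `1` by an amount quadratic in the ratio of the translation to the radius. -/
theorem one_sub_le_sum_noiseAmp_mul (s s' : ℤ) :
    1 - 6 * ((s : ℝ) - s') ^ 2 / M ^ 2 ≤
      ∑ x : ZMod (4 * M), noiseAmp M (x - (s : ZMod (4 * M))) *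
        noiseAmp M (x - (s' : ZMod (4 * M))) := by
  have hM : (0 : ℝ) < M := by exact_mod_cast NeZero.pos M
  set S := ∑ x, tent M x ^ 2
  have hSpos : 0 < S := sum_tent_sq_pos
  have hSle : (M : ℝ) ^ 3 / 3 ≤ S := le_sum_tent_sq
  have hsum : ∀ c : ℤ, ∑ x : ZMod (4 * M), noiseAmp M (x - c) ^ 2 = 1 := by
    intro c
    have h := (Equiv.subRight (c : ZMod (4 * M))).sum_comp fun x => noiseAmp M x ^ 2
    simp only [Equiv.subRight_apply] at h
    rw [h, sum_noiseAmp_sq]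
  have hdiff : ∀ x : ZMod (4 * M), (noiseAmp M (x - s) - noiseAmp M (x - s')) ^ 2 ≤
      ((s : ℝ) - s') ^ 2 / S := by
    intro x
    rw [noiseAmp, noiseAmp, ← sub_div, div_pow, Real.sq_sqrt hSpos.le]
    refine div_le_div_of_nonneg_right ?_ hSpos.le
    have h := abs_tent_add_intCast_sub_le (x - (s : ZMod (4 * M))) (s - s')
    rw [Int.cast_sub, sub_add_sub_cancel, Int.cast_sub] at h
    rw [← sq_abs, abs_sub_comm, ← sq_abs ((s : ℝ) - s')]
    exact pow_le_pow_left₀ (abs_nonneg _) h 2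
  have h1 : ∑ x : ZMod (4 * M), (noiseAmp M (x - s) - noiseAmp M (x - s')) ^ 2 ≤
      4 * M * (((s : ℝ) - s') ^ 2 / S) := by
    refine (Finset.sum_le_sum fun x _ => hdiff x).trans (le_of_eq ?_)
    simp [ZMod.card]
  have h2 : 4 * M * (((s : ℝ) - s') ^ 2 / S) ≤ 12 * ((s : ℝ) - s') ^ 2 / M ^ 2 := by
    rw [mul_div_assoc', div_le_div_iff₀ hSpos (by positivity)]
    nlinarith [mul_le_mul_of_nonneg_left hSle (sq_nonneg ((s : ℝ) - s'))]
  have h3 : ∑ x : ZMod (4 * M), (noiseAmp M (x - s) - noiseAmp M (x - s')) ^ 2 =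
      2 - 2 * ∑ x : ZMod (4 * M), noiseAmp M (x - s) * noiseAmp M (x - s') := by
    simp_rw [sub_sq, Finset.sum_add_distrib, Finset.sum_sub_distrib, hsum, mul_assoc,
      ← Finset.mul_sum]
    ring
  have h4 : 12 * ((s : ℝ) - s') ^ 2 / M ^ 2 = 2 * (6 * ((s : ℝ) - s') ^ 2 / M ^ 2) := by ring
  linarith

end Tent

/-! ### Loss vectors with hidden signs -/

section Loss

variable {n : ℕ}

/-- The sign of a bit: `1` for `true` and `-1` for `false`. -/
def sgn (b : Bool) : ℤ := if b then 1 else -1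

/-- The number of coordinates of the vertex `X` that are `1`. -/
def ones (X : Vertex n) : ℕ := (Finset.univ.filter fun i => X i = true).card

/-- The scalar product of the vertex `X` and the sign vector of `θ`. -/
def bal (θ X : Vertex n) : ℤ := ∑ i, if X i then sgn (θ i) else 0

/-- The vertex `θ` with the `i`-th coordinate negated. -/
def flip (i : Fin n) (θ : Vertex n) : Vertex n := Function.update θ i (!θ i)

/-- The loss vector with sign vector `θ` and noise `x`: every coordinate of it is the sum of a bias
of absolute value `m / (4 M)`, whose sign is given by `θ`, and of a noise term common to all the
coordinates. -/
noncomputable def lossVec (m M : ℕ) (θ : Vertex n) (x : ZMod (4 * M)) (i : Fin n) : ℝ :=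
  (m * sgn (θ i) + x.valMinAbs) / (4 * M)

/-- The translation by which the signs `θ` move the noise in the loss of `X`, when this loss is
measured in units of `ones X / (4 M)`. The division is exact if `m` is a multiple of `ones X`. -/
def shift (m : ℕ) (θ X : Vertex n) : ℤ := (m / ones X : ℕ) * bal θ X

theorem abs_sgn (b : Bool) : |sgn b| = 1 := by
  cases b <;> rfl

theorem ones_le (X : Vertex n) : ones X ≤ n :=
  (Finset.card_le_univ _).trans_eq (Fintype.card_fin n)

theorem sum_ite_eq_ones_mul (X : Vertex n) (c : ℝ) :
    (∑ i, if X i then c else 0) = ones X * c := by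
  rw [← Finset.sum_filter, Finset.sum_const, nsmul_eq_mul, ones]

theorem abs_bal_le (θ X : Vertex n) : |bal θ X| ≤ ones X := by
  refine (Finset.abs_sum_le_sum_abs _ _).trans (le_of_eq ?_)
  rw [ones, Finset.card_filter, Nat.cast_sum]
  refine Finset.sum_congr rfl fun i _ => ?_
  split_ifs <;> simp [abs_sgn]

theorem cost_lossVec (m M : ℕ) (θ X : Vertex n) (x : ZMod (4 * M)) :
    cost X (lossVec m M θ x) = (m * bal θ X + ones X * x.valMinAbs) / (4 * M) := by
  rw [← sum_ite_eq_ones_mul, bal, Int.cast_sum, Finset.mul_sum, ← Finset.sum_add_distrib,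
    Finset.sum_div, cost]
  refine Finset.sum_congr rfl fun i _ => ?_
  split_ifs <;> simp [lossVec]

theorem abs_lossVec_le {m M : ℕ} [NeZero M] (hm : m ≤ M) (θ : Vertex n) (x : ZMod (4 * M))
    (i : Fin n) : |lossVec m M θ x i| ≤ 1 := by
  have hM : (0 : ℝ) < M := by exact_mod_cast NeZero.pos M
  have h1 : |(x.valMinAbs : ℝ)| ≤ 2 * M := by
    have h := ZMod.natAbs_valMinAbs_le x
    have h' : |x.valMinAbs| ≤ 2 * M := by rw [Int.abs_eq_natAbs]; omega
    exact_mod_cast h'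
  have h2 : |(m * sgn (θ i) : ℝ)| ≤ M := by
    have h : |(sgn (θ i) : ℝ)| = 1 := by exact_mod_cast abs_sgn (θ i)
    rw [abs_mul, h, mul_one, Nat.abs_cast]
    exact_mod_cast hm
  rw [lossVec, abs_div, abs_of_pos (by positivity : (0 : ℝ) < 4 * M), div_le_one (by positivity)]
  linarith [abs_add_le (m * sgn (θ i) : ℝ) x.valMinAbs]

/-- On the support of the noise, the loss of `X` is a function of `X` and of the translated
noise: the translation does not wrap around in the cyclic group. -/
theorem cost_lossVec_eq_shift {m M : ℕ} [NeZero M] (hm : m ≤ M)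
    (hdvd : ∀ k, 0 < k → k ≤ n → k ∣ m) (θ X : Vertex n) {x : ZMod (4 * M)}
    (hx : |x.valMinAbs| < M) :
    cost X (lossVec m M θ x) =
      ones X * ((x + (shift m θ X : ZMod (4 * M))).valMinAbs : ℝ) / (4 * M) := by
  rcases Nat.eq_zero_or_pos (ones X) with h0 | hpos
  · have hb : bal θ X = 0 := by
      have := abs_bal_le θ X
      rw [h0] at this
      exact abs_nonpos_iff.1 this
    rw [cost_lossVec, h0, hb]
    simp
  · have hk : ((m / ones X : ℕ) : ℤ) * ones X = m := by
      exact_mod_cast Nat.div_mul_cancel (hdvd _ hpos (ones_le X))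
    have hs : |shift m θ X| ≤ M := by
      rw [shift, abs_mul, Nat.abs_cast]
      calc ((m / ones X : ℕ) : ℤ) * |bal θ X| ≤ (m / ones X : ℕ) * ones X :=
            mul_le_mul_of_nonneg_left (abs_bal_le θ X) (by positivity)
        _ = m := hk
        _ ≤ M := by exact_mod_cast hm
    have hv : (x + (shift m θ X : ZMod (4 * M))).valMinAbs = x.valMinAbs + shift m θ X := by
      rw [ZMod.valMinAbs_spec]
      refine ⟨by push_cast; simp, ?_⟩
      rw [abs_lt] at hx
      rw [abs_le] at hs
      push_cast
      constructor <;> omega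
    have hk' : ((m / ones X : ℕ) : ℝ) * ones X = m := by exact_mod_cast hk
    rw [cost_lossVec, hv, shift, ← hk', Int.cast_add, Int.cast_mul, Int.cast_natCast]
    ring

theorem flip_involutive (i : Fin n) : Function.Involutive (flip i) := by
  intro θ
  simp [flip]

theorem abs_bal_sub_bal_flip_le (i : Fin n) (θ X : Vertex n) :
    |bal θ X - bal (flip i θ) X| ≤ if X i then 2 else 0 := by
  rw [bal, bal, ← Finset.sum_sub_distrib, Finset.sum_eq_single i]
  · cases hX : X i
    · simp
    · cases hθ : θ i <;> simp [flip, sgn, hθ]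
  · intro j _ hj
    simp [flip, Function.update_of_ne hj]
  · simp

/-- The number of coordinates in which `X` differs from the vertex optimal for the signs `θ`,
which is the complement of `θ`. -/
def numErr (θ X : Vertex n) : ℝ := ∑ i, if X i = θ i then 1 else 0

theorem cost_sub_cost_compl (m M : ℕ) (θ X : Vertex n) (x : ZMod (4 * M)) :
    cost X (lossVec m M θ x) - cost (fun i => !θ i) (lossVec m M θ x) =
      m / (4 * M) * numErr θ X +
        (ones X - ones fun i => !θ i) / (4 * M) * (x.valMinAbs : ℝ) := by
  have h : (bal θ X : ℝ) - bal θ (fun i => !θ i) = numErr θ X := by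
    rw [bal, bal, numErr, Int.cast_sum, Int.cast_sum, ← Finset.sum_sub_distrib]
    refine Finset.sum_congr rfl fun i _ => ?_
    cases X i <;> cases θ i <;> simp [sgn]
  rw [cost_lossVec, cost_lossVec, ← h]
  ring

end Loss

/-! ### The game against the noisy adversary -/

section Game

variable {n : ℕ} {Ω : Type*} [MeasurableSpace Ω]

/-- The scalar losses that a learner with internal randomization `ω` incurs, as a function of the
history of translated noises. -/
noncomputable def feedback (L : Learner n Ω) (M : ℕ) (ω : Ω) :
    (t : ℕ) → (Fin t → ZMod (4 * M)) → Fin t → ℝ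
  | 0, _ => Fin.elim0
  | t + 1, o => Fin.snoc (feedback L M ω t (Fin.init o))
      (ones (L.act t ω (feedback L M ω t (Fin.init o))) * ((o (Fin.last t)).valMinAbs : ℝ) /
        (4 * M))

/-- The action of a learner with internal randomization `ω`, as a function of the history of
translated noises. -/
noncomputable def play (L : Learner n Ω) (M : ℕ) (ω : Ω) (t : ℕ) (o : Fin t → ZMod (4 * M)) :
    Vertex n :=
  L.act t ω (feedback L M ω t o)

/-- The randomization of the adversary: one noise per round. -/
abbrev Noise (M T : ℕ) : Type := Fin T → ZMod (4 * M)

/-- The oblivious adversary that draws the loss vectors with fixed signs `θ` and independent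
noise. -/
noncomputable def noisyAdversary {m M : ℕ} [NeZero M] (hm : m ≤ M) (T : ℕ) (θ : Vertex n) :
    Adversary n (Noise M T) where
  loss t z _ := lossVec m M θ (ext z t)
  measurable_loss t :=
    (Measurable.of_discrete (f := fun z : Noise M T => lossVec m M θ (ext z t))).comp
      measurable_fst
  norm_loss_le t z _ := by
    rw [pi_norm_le_iff_of_nonneg zero_le_one]
    exact fun i => abs_lossVec_le hm θ _ i

theorem noisyAdversary_isOblivious {m M : ℕ} [NeZero M] (hm : m ≤ M) (T : ℕ) (θ : Vertex n) :
    (noisyAdversary hm T θ).IsOblivious :=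
  fun _ _ _ _ => rfl

theorem round_snd {m M : ℕ} [NeZero M] (hm : m ≤ M) (T : ℕ) (θ : Vertex n) (L : Learner n Ω)
    (ω : Ω) (z : Noise M T) (t : ℕ) :
    (round L (noisyAdversary hm T θ) ω z t).2 = lossVec m M θ (ext z t) := by
  rw [round]
  rfl

/-- The translations of the noise that the actions of the learner lead to. -/
noncomputable def gameShift (L : Learner n Ω) (m M : ℕ) (ω : Ω) (θ : Vertex n) (t : ℕ)
    (o : Fin t → ZMod (4 * M)) : ZMod (4 * M) :=
  (shift m θ (play L M ω t o) : ℤ)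

/-- On the support of the noise, the actions in the game are those of the learner on the history of
translated noises. -/
theorem round_fst {m M : ℕ} [NeZero M] (hm : m ≤ M) (hdvd : ∀ k, 0 < k → k ≤ n → k ∣ m) {T : ℕ}
    (θ : Vertex n) (L : Learner n Ω) (ω : Ω) (z : Noise M T) {t : ℕ}
    (hz : ∀ s < t, |(ext z s).valMinAbs| < M) :
    (round L (noisyAdversary hm T θ) ω z t).1 =
      play L M ω t (hist (gameShift L m M ω θ) (ext z) t) := by
  have hact : ∀ t, (round L (noisyAdversary hm T θ) ω z t).1 = L.act t ω fun s : Fin t =>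
      cost (round L (noisyAdversary hm T θ) ω z s).1 (round L (noisyAdversary hm T θ) ω z s).2 := by
    intro t
    rw [round]
  rw [hact, play]
  congr 1
  induction t with
  | zero => exact Subsingleton.elim _ _
  | succ t ih =>
    have ih' := ih fun s hs => hz s (hs.trans t.lt_succ_self)
    ext s
    induction s using Fin.lastCases with
    | last =>
      simp only [feedback, hist, Fin.init_snoc, Fin.snoc_last, Fin.val_last]
      rw [round_snd, hact, ih', cost_lossVec_eq_shift hm hdvd _ _ (hz t t.lt_succ_self)]
      rfl
    | cast s =>
      simp only [feedback, hist, Fin.init_snoc, Fin.snoc_castSucc, Fin.val_castSucc]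
      exact congrFun ih' s

/-- The regret is at least the regret against the complement of `θ`. -/
theorem le_regret {m M : ℕ} [NeZero M] (hm : m ≤ M) (hdvd : ∀ k, 0 < k → k ≤ n → k ∣ m) {T : ℕ}
    (θ : Vertex n) (L : Learner n Ω) (ω : Ω) (z : Noise M T)
    (hz : ∀ s < T, |(ext z s).valMinAbs| < M) :
    ∑ t ∈ Finset.range T, (m / (4 * M) *
        numErr θ (play L M ω t (hist (gameShift L m M ω θ) (ext z) t)) +
      ((ones (play L M ω t (hist (gameShift L m M ω θ) (ext z) t)) : ℝ) -
        ones fun i => !θ i) / (4 * M) * ((ext z t).valMinAbs : ℝ)) ≤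
      regret L (noisyAdversary hm T θ) T ω z := by
  have hinf := Finset.inf'_le (s := Finset.univ) (fun X : Vertex n => ∑ t ∈ Finset.range T,
    cost X (round L (noisyAdversary hm T θ) ω z t).2) (Finset.mem_univ fun i => !θ i)
  refine le_trans (le_of_eq ?_) (sub_le_sub_left hinf _)
  rw [← Finset.sum_sub_distrib]
  refine Finset.sum_congr rfl fun t ht => ?_
  rw [round_snd, round_fst hm hdvd θ L ω z fun s hs => hz s (hs.trans (Finset.mem_range.1 ht)),
    cost_sub_cost_compl]

/-- Given the internal randomization of the learner, the expected regret is at least the bias times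
the expected number of wrong coordinates: the noise of a round is centred and independent of the
action. -/
theorem sum_amp_sq_mul_numErr_le_sum_regret {m M : ℕ} [NeZero M] (hm : m ≤ M)
    (hdvd : ∀ k, 0 < k → k ≤ n → k ∣ m) {T : ℕ} (θ : Vertex n) (L : Learner n Ω) (ω : Ω) :
    m / (4 * M) * ∑ t ∈ Finset.range T, ∑ o, amp (noiseAmp M) (gameShift L m M ω θ) t o ^ 2 *
        numErr θ (play L M ω t o) ≤
      ∑ z : Noise M T, (∏ s, noiseAmp M (z s) ^ 2) * regret L (noisyAdversary hm T θ) T ω z := by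
  set a := gameShift L m M ω θ
  have hle : ∀ z : Noise M T, (∏ s, noiseAmp M (z s) ^ 2) *
      (∑ t ∈ Finset.range T, (m / (4 * M) * numErr θ (play L M ω t (hist a (ext z) t)) +
      ((ones (play L M ω t (hist a (ext z) t)) : ℝ) - ones fun i => !θ i) / (4 * M) *
        ((ext z t).valMinAbs : ℝ))) ≤
      (∏ s, noiseAmp M (z s) ^ 2) * regret L (noisyAdversary hm T θ) T ω z := by
    intro z
    by_cases hz : ∏ s, noiseAmp M (z s) ^ 2 = 0
    · simp [hz]
    · -- A noise sequence of positive weight lies in the support of the noise.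
      refine mul_le_mul_of_nonneg_left (le_regret hm hdvd θ L ω z fun s hs => ?_)
        (Finset.prod_nonneg fun s _ => sq_nonneg _)
      rw [ext_of_lt _ hs]
      refine abs_valMinAbs_lt_of_noiseAmp_ne_zero fun h => hz ?_
      exact Finset.prod_eq_zero (Finset.mem_univ ⟨s, hs⟩) (by rw [h]; simp)
  refine le_trans (le_of_eq ?_) (Finset.sum_le_sum fun z _ => hle z)
  simp_rw [Finset.mul_sum, mul_add]
  rw [Finset.sum_comm]
  refine Finset.sum_congr rfl fun t ht => ?_
  have ht' := Finset.mem_range.1 ht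
  have h0 : ∑ z : Fin T → ZMod (4 * M), (∏ s, noiseAmp M (z s) ^ 2) *
      (((ones (play L M ω t (hist a (ext z) t)) : ℝ) - ones fun i => !θ i) / (4 * M) *
        ((ext z t).valMinAbs : ℝ)) = 0 := by
    have h := sum_prod_mul_eq_resample (w := fun x => noiseAmp M x ^ 2) sum_noiseAmp_sq ⟨t, ht'⟩
      (fun z x => ((ones (play L M ω t (hist a (ext z) t)) : ℝ) - ones fun i => !θ i) / (4 * M) *
        (x.valMinAbs : ℝ)) (by
        intro z x y
        have : hist a (ext (Function.update z ⟨t, ht'⟩ y)) t = hist a (ext z) t :=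
          hist_congr a fun s hs => ext_update_of_ne z ht' y hs.ne
        simp only [this])
    simp only [ext_of_lt _ ht']
    rw [h]
    refine Finset.sum_eq_zero fun z _ => ?_
    simp_rw [mul_left_comm _ (_ / _ : ℝ), ← Finset.mul_sum, sum_noiseAmp_sq_mul_valMinAbs, mul_zero]
  have h1 := sum_prod_mul_hist (T := T) (sum_noiseAmp_sq (M := M)) a ht'.le
    fun o => m / (4 * M) * numErr θ (play L M ω t o)
  rw [Finset.sum_add_distrib]
  refine Eq.trans ?_ (congrArg₂ (· + ·) h1 h0).symm
  rw [add_zero]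
  exact Finset.sum_congr rfl fun o _ => by ring

end Game

/-! ### Averaging over the signs -/

section Average

variable {n : ℕ} {Ω : Type*} [MeasurableSpace Ω]

/-- The bound on the Hellinger distance of the laws of the observation for two sign vectors that
differ in the coordinate `i` only, when the vertex `X` is played. -/
noncomputable def flipInfo (q : ℕ) (i : Fin n) (X : Vertex n) : ℝ :=
  if X i then 24 / ((ones X : ℝ) ^ 2 * q ^ 2) else 0

theorem flipInfo_nonneg (q : ℕ) (i : Fin n) (X : Vertex n) : 0 ≤ flipInfo q i X := by
  unfold flipInfo
  split_ifs <;> positivity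

/-- An action `X` yields information about `ones X` coordinates, but the more coordinates there are,
the larger is the noise. -/
theorem sum_flipInfo_le (q : ℕ) (X : Vertex n) : ∑ i, flipInfo q i X ≤ 24 / q ^ 2 := by
  simp_rw [flipInfo, sum_ite_eq_ones_mul]
  rcases Nat.eq_zero_or_pos (ones X) with h | h
  · rw [h]
    simp only [Nat.cast_zero, zero_mul]
    positivity
  · have h1 : (1 : ℝ) ≤ ones X := by exact_mod_cast h
    have h2 : (ones X : ℝ) * (24 / ((ones X : ℝ) ^ 2 * q ^ 2)) = 24 / q ^ 2 / ones X := by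
      field_simp
    rw [h2]
    exact div_le_self (by positivity) h1

theorem one_sub_flipInfo_le {m q M : ℕ} [NeZero M] (hM : M = m * q) (i : Fin n)
    (θ X : Vertex n) :
    1 - flipInfo q i X ≤ ∑ x : ZMod (4 * M), noiseAmp M (x - (shift m θ X : ZMod (4 * M))) *
      noiseAmp M (x - (shift m (flip i θ) X : ZMod (4 * M))) := by
  refine le_trans ?_ (one_sub_le_sum_noiseAmp_mul _ _)
  have hM0 : (0 : ℝ) < M := by exact_mod_cast NeZero.pos M
  have hmq : (M : ℝ) = m * q := by exact_mod_cast hM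
  have hb := abs_bal_sub_bal_flip_le i θ X
  have hsub : ((shift m θ X : ℤ) : ℝ) - (shift m (flip i θ) X : ℤ) =
      (m / ones X : ℕ) * ((bal θ X - bal (flip i θ) X : ℤ) : ℝ) := by
    simp only [shift, Int.cast_mul, Int.cast_natCast, Int.cast_sub]
    ring
  rw [hsub, flipInfo]
  split_ifs with hX
  · rw [if_pos hX] at hb
    have hpos : 0 < ones X := Finset.card_pos.2 ⟨i, by simpa using hX⟩
    have hk : (0 : ℝ) < ones X := by exact_mod_cast hpos
    have hd : ((bal θ X - bal (flip i θ) X : ℤ) : ℝ) ^ 2 ≤ 4 := by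
      have : |((bal θ X - bal (flip i θ) X : ℤ) : ℝ)| ≤ 2 := by exact_mod_cast hb
      rw [← sq_abs]
      nlinarith [abs_nonneg ((bal θ X - bal (flip i θ) X : ℤ) : ℝ)]
    have hc : ((m / ones X : ℕ) : ℝ) ≤ m / ones X := Nat.cast_div_le
    have hc2 : ((m / ones X : ℕ) : ℝ) ^ 2 ≤ (m / ones X) ^ 2 :=
      pow_le_pow_left₀ (Nat.cast_nonneg _) hc 2
    have hm0 : (m : ℝ) ≠ 0 := fun h => hM0.ne' (by rw [hmq, h, zero_mul])
    have hq0 : (q : ℝ) ≠ 0 := fun h => hM0.ne' (by rw [hmq, h, mul_zero])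
    refine sub_le_sub_left ?_ 1
    calc 6 * (((m / ones X : ℕ) : ℝ) * ((bal θ X - bal (flip i θ) X : ℤ) : ℝ)) ^ 2 / (M : ℝ) ^ 2
        ≤ 6 * ((m / ones X) ^ 2 * 4) / (M : ℝ) ^ 2 := by
          rw [mul_pow]
          gcongr
      _ = 24 / ((ones X : ℝ) ^ 2 * q ^ 2) := by
          rw [hmq]
          field_simp
          norm_num
  · rw [if_neg hX] at hb
    have : bal θ X - bal (flip i θ) X = 0 := abs_nonpos_iff.1 hb
    rw [this]
    simp

/-- The two-point argument for one coordinate: an action that is right for `θ` is wrong for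
`flip i θ`, and the minimum of the two likelihoods is at least the square root of their product
minus a quarter of their sum. -/
theorem amp_mul_amp_sub_le (a b : ℝ) (i : Fin n) (θ X : Vertex n) :
    a * b - (a ^ 2 + b ^ 2) / 4 ≤
      (a ^ 2 * if X i = θ i then 1 else 0) + b ^ 2 * if X i = flip i θ i then 1 else 0 := by
  have h : flip i θ i = !θ i := by simp [flip]
  rw [h]
  cases X i <;> cases θ i <;> simp <;> nlinarith [sq_nonneg (a - 2 * b), sq_nonneg (b - 2 * a),
    sq_nonneg a, sq_nonneg b]

theorem sum_flip (i : Fin n) (f : Vertex n → ℝ) : ∑ θ, f (flip i θ) = ∑ θ, f θ :=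
  Equiv.sum_comp (Function.Involutive.toPerm _ (flip_involutive i)) f

/-- The total information about coordinate `i`, averaged over the signs, controls how often the
action is wrong in this coordinate. -/
theorem sum_sub_le_sum_err {m q M : ℕ} [NeZero M] (hM : M = m * q) (L : Learner n Ω) (ω : Ω)
    (t : ℕ) (i : Fin n) :
    (2 : ℝ) ^ n / 2 - ∑ s ∈ Finset.range t, ∑ θ, ∑ o,
        amp (noiseAmp M) (gameShift L m M ω θ) s o ^ 2 * flipInfo q i (play L M ω s o) ≤
      2 * ∑ θ : Vertex n, ∑ o, amp (noiseAmp M) (gameShift L m M ω θ) t o ^ 2 *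
        if play L M ω t o i = θ i then 1 else 0 := by
  set U : Vertex n → (s : ℕ) → (Fin s → ZMod (4 * M)) → ℝ :=
    fun θ => amp (noiseAmp M) (gameShift L m M ω θ)
  have hU1 : ∀ θ s, ∑ o, U θ s o ^ 2 = 1 := fun θ s => sum_amp_sq sum_noiseAmp_sq _ s
  have haff : ∀ θ, 1 - ∑ s ∈ Finset.range t, ∑ o, (U θ s o ^ 2 + U (flip i θ) s o ^ 2) / 2 *
      flipInfo q i (play L M ω s o) ≤ ∑ o, U θ t o * U (flip i θ) t o := fun θ =>
    one_sub_le_sum_amp_mul_amp noiseAmp_nonneg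
      (δ := fun s o => flipInfo q i (play L M ω s o)) (fun s o => flipInfo_nonneg q i _)
      (fun s o => one_sub_flipInfo_le hM i θ _) t
  have herr : ∀ θ, ∑ o, U θ t o * U (flip i θ) t o - 1 / 2 ≤
      (∑ o, U θ t o ^ 2 * if play L M ω t o i = θ i then 1 else 0) +
      ∑ o, U (flip i θ) t o ^ 2 * if play L M ω t o i = flip i θ i then 1 else 0 := by
    intro θ
    rw [← Finset.sum_add_distrib]
    refine le_trans (le_of_eq ?_) (Finset.sum_le_sum fun o _ =>
      amp_mul_amp_sub_le (U θ t o) (U (flip i θ) t o) i θ (play L M ω t o))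
    rw [Finset.sum_sub_distrib, ← Finset.sum_div, Finset.sum_add_distrib, hU1, hU1]
    norm_num
  have hsum := Finset.sum_le_sum fun θ (_ : θ ∈ (Finset.univ : Finset (Vertex n))) =>
    (sub_le_sub_right (haff θ) (1 / 2)).trans (herr θ)
  rw [Finset.sum_add_distrib, sum_flip i fun θ => ∑ o, U θ t o ^ 2 *
    if play L M ω t o i = θ i then 1 else 0, ← two_mul] at hsum
  refine le_trans (le_of_eq ?_) hsum
  have hinfo : ∀ s, ∑ θ : Vertex n, ∑ o, (U θ s o ^ 2 + U (flip i θ) s o ^ 2) / 2 *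
      flipInfo q i (play L M ω s o) = ∑ θ, ∑ o, U θ s o ^ 2 * flipInfo q i (play L M ω s o) := by
    intro s
    have h1 : ∀ θ : Vertex n, ∑ o, (U θ s o ^ 2 + U (flip i θ) s o ^ 2) / 2 *
        flipInfo q i (play L M ω s o) =
        (∑ o, U θ s o ^ 2 * flipInfo q i (play L M ω s o)) / 2 +
        (∑ o, U (flip i θ) s o ^ 2 * flipInfo q i (play L M ω s o)) / 2 := by
      intro θ
      rw [Finset.sum_div, Finset.sum_div, ← Finset.sum_add_distrib]
      exact Finset.sum_congr rfl fun o _ => by ring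
    simp_rw [h1, Finset.sum_add_distrib]
    rw [sum_flip i fun θ => (∑ o, U θ s o ^ 2 * flipInfo q i (play L M ω s o)) / 2,
      ← Finset.sum_div, add_halves]
  have hinfo' : ∑ θ : Vertex n, ∑ s ∈ Finset.range t, ∑ o, (U θ s o ^ 2 + U (flip i θ) s o ^ 2) /
      2 * flipInfo q i (play L M ω s o) = ∑ s ∈ Finset.range t, ∑ θ, ∑ o, U θ s o ^ 2 *
        flipInfo q i (play L M ω s o) := by
    rw [Finset.sum_comm]
    exact Finset.sum_congr rfl fun s _ => hinfo s
  rw [Finset.sum_sub_distrib, Finset.sum_sub_distrib, hinfo']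
  simp
  ring

theorem le_sum_amp_sq_mul_numErr {m q M : ℕ} [NeZero M] (hM : M = m * q) (L : Learner n Ω)
    (ω : Ω) {t : ℕ} (ht : 96 * (t : ℝ) ≤ n * q ^ 2) :
    (2 : ℝ) ^ n * n / 8 ≤ ∑ θ : Vertex n, ∑ o,
      amp (noiseAmp M) (gameShift L m M ω θ) t o ^ 2 * numErr θ (play L M ω t o) := by
  have hq : (0 : ℝ) < q := by
    have : q ≠ 0 := by
      rintro rfl
      exact NeZero.ne M (by simpa using hM)
    exact_mod_cast Nat.pos_of_ne_zero this
  have h := Finset.sum_le_sum fun i (_ : i ∈ (Finset.univ : Finset (Fin n))) =>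
    sum_sub_le_sum_err hM L ω t i
  have hR : ∑ θ : Vertex n, ∑ o,
      amp (noiseAmp M) (gameShift L m M ω θ) t o ^ 2 * numErr θ (play L M ω t o) =
      ∑ i, ∑ θ : Vertex n, ∑ o, amp (noiseAmp M) (gameShift L m M ω θ) t o ^ 2 *
        if play L M ω t o i = θ i then 1 else 0 := by
    simp_rw [numErr, Finset.mul_sum]
    symm
    rw [Finset.sum_comm]
    refine Finset.sum_congr rfl fun θ _ => ?_
    rw [Finset.sum_comm]
  have hI : ∑ i, ∑ s ∈ Finset.range t, ∑ θ : Vertex n, ∑ o,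
      amp (noiseAmp M) (gameShift L m M ω θ) s o ^ 2 * flipInfo q i (play L M ω s o) ≤
      2 ^ n * (t * (24 / q ^ 2)) := by
    rw [Finset.sum_comm]
    calc _ ≤ ∑ s ∈ Finset.range t, ∑ θ : Vertex n, (24 / (q : ℝ) ^ 2) := by
          refine Finset.sum_le_sum fun s _ => ?_
          rw [Finset.sum_comm]
          refine Finset.sum_le_sum fun θ _ => ?_
          rw [Finset.sum_comm]
          calc _ ≤ ∑ o, amp (noiseAmp M) (gameShift L m M ω θ) s o ^ 2 * (24 / (q : ℝ) ^ 2) := by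
                refine Finset.sum_le_sum fun o _ => ?_
                rw [← Finset.mul_sum]
                exact mul_le_mul_of_nonneg_left (sum_flipInfo_le q _) (sq_nonneg _)
            _ = _ := by
                rw [← Finset.sum_mul, sum_amp_sq sum_noiseAmp_sq, one_mul]
      _ = _ := by
          simp
          ring
  rw [← Finset.mul_sum, ← hR, Finset.sum_sub_distrib] at h
  have ht4 : (t : ℝ) * (24 / q ^ 2) ≤ n / 4 := by
    rw [mul_div_assoc', div_le_iff₀ (by positivity)]
    linarith
  have h4 := mul_le_mul_of_nonneg_left ht4 (by positivity : (0 : ℝ) ≤ 2 ^ n)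
  simp only [Finset.sum_const, Finset.card_univ, Fintype.card_fin, nsmul_eq_mul] at h
  linarith

end Average

/-! ### Expectations over the randomizations -/

section Expectation

variable {n : ℕ} {Ω : Type*} [MeasurableSpace Ω]

/-- The law of the noises: independent, each with the law `noiseAmp M ^ 2`. -/
noncomputable def noisePMF (M T : ℕ) [NeZero M] : PMF (Noise M T) :=
  PMF.ofFintype (fun z => ENNReal.ofReal (∏ s, noiseAmp M (z s) ^ 2)) (by
    rw [← ENNReal.ofReal_sum_of_nonneg fun z _ => Finset.prod_nonneg fun s _ => sq_nonneg _]
    have h : ∑ z : Noise M T, ∏ s, noiseAmp M (z s) ^ 2 = 1 := by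
      have h := Fintype.prod_sum fun (_ : Fin T) x => noiseAmp M x ^ 2
      simp only [sum_noiseAmp_sq, Finset.prod_const_one] at h
      exact h.symm
    rw [h, ENNReal.ofReal_one])

theorem measurable_cost (l : Fin n → ℝ) : Measurable fun X : Vertex n => cost X l :=
  Measurable.of_discrete

theorem measurable_round_fst {m M : ℕ} [NeZero M] (hm : m ≤ M) (T : ℕ) (θ : Vertex n)
    (L : Learner n Ω) (z : Noise M T) (t : ℕ) :
    Measurable fun ω => (round L (noisyAdversary hm T θ) ω z t).1 := by
  induction t using Nat.strong_induction_on with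
  | _ t ih =>
    have h : (fun ω => (round L (noisyAdversary hm T θ) ω z t).1) = fun ω =>
        L.act t ω fun s : Fin t => cost (round L (noisyAdversary hm T θ) ω z s).1
          (lossVec m M θ (ext z s)) := by
      funext ω
      rw [round]
      simp only [round_snd]
    rw [h]
    exact (L.measurable_act t).comp (measurable_id.prodMk (measurable_pi_lambda _ fun s =>
      (measurable_cost _).comp (ih s s.isLt)))

theorem measurable_regret {m M : ℕ} [NeZero M] (hm : m ≤ M) (T : ℕ) (θ : Vertex n)
    (L : Learner n Ω) :
    Measurable fun p : Ω × Noise M T => regret L (noisyAdversary hm T θ) T p.1 p.2 := by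
  refine measurable_from_prod_countable_left fun z => ?_
  simp only [regret, round_snd]
  exact (Finset.measurable_sum _ fun t _ =>
    (measurable_cost _).comp (measurable_round_fst hm T θ L z t)).sub_const _

theorem abs_cost_le (X : Vertex n) {l : Fin n → ℝ} (hl : ‖l‖ ≤ 1) : |cost X l| ≤ n := by
  refine (Finset.abs_sum_le_sum_abs _ _).trans ?_
  calc _ ≤ ∑ _i : Fin n, (1 : ℝ) := by
        refine Finset.sum_le_sum fun i _ => ?_
        split_ifs
        · exact (norm_le_pi_norm l i).trans hl
        · simp
    _ = n := by simp

theorem abs_regret_le {Ω' : Type*} [MeasurableSpace Ω'] (L : Learner n Ω) (A : Adversary n Ω')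
    (T : ℕ) (ω : Ω) (ω' : Ω') : |regret L A T ω ω'| ≤ 2 * (T * n) := by
  have hl : ∀ t, ‖(round L A ω ω' t).2‖ ≤ 1 := by
    intro t
    rw [round]
    exact A.norm_loss_le _ _ _
  have hsum : ∀ X : ℕ → Vertex n,
      |∑ t ∈ Finset.range T, cost (X t) (round L A ω ω' t).2| ≤ T * n := by
    intro X
    refine (Finset.abs_sum_le_sum_abs _ _).trans ?_
    refine (Finset.sum_le_sum fun t _ => abs_cost_le (X t) (hl t)).trans (le_of_eq ?_)
    simp
  obtain ⟨X, -, hX⟩ := Finset.exists_mem_eq_inf' (Finset.univ_nonempty (α := Vertex n))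
    fun X : Vertex n => ∑ t ∈ Finset.range T, cost X (round L A ω ω' t).2
  rw [regret, hX]
  have h1 := hsum fun t => (round L A ω ω' t).1
  have h2 := hsum fun _ => X
  exact (abs_sub _ _).trans (by linarith)

theorem integrable_regret (P : Measure Ω) [IsProbabilityMeasure P] {m M : ℕ} [NeZero M]
    (hm : m ≤ M) (T : ℕ) (θ : Vertex n) (L : Learner n Ω) :
    Integrable (fun p : Ω × Noise M T => regret L (noisyAdversary hm T θ) T p.1 p.2)
      (P.prod (noisePMF M T).toMeasure) :=
  Integrable.of_bound (measurable_regret hm T θ L).aestronglyMeasurable (2 * (T * n))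
    (Filter.Eventually.of_forall fun p => abs_regret_le L _ T p.1 p.2)

theorem integral_regret_noisePMF {m M : ℕ} [NeZero M] (hm : m ≤ M) (T : ℕ) (θ : Vertex n)
    (L : Learner n Ω) (ω : Ω) :
    ∫ z, regret L (noisyAdversary hm T θ) T ω z ∂(noisePMF M T).toMeasure =
      ∑ z : Noise M T, (∏ s, noiseAmp M (z s) ^ 2) * regret L (noisyAdversary hm T θ) T ω z := by
  rw [PMF.integral_eq_sum]
  refine Finset.sum_congr rfl fun z _ => ?_
  rw [noisePMF, PMF.ofFintype_apply,
    ENNReal.toReal_ofReal (Finset.prod_nonneg fun s _ => sq_nonneg _), smul_eq_mul]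

/-- Averaging over the signs: some choice of the signs, which depends on the learner, forces a
regret of a constant times the bias in each round and coordinate. -/
theorem exists_le_expectedRegret (P : Measure Ω) [IsProbabilityMeasure P] {m q M : ℕ} [NeZero M]
    (hm : m ≤ M) (hM : M = m * q) (hdvd : ∀ k, 0 < k → k ≤ n → k ∣ m) {T : ℕ}
    (hT : 96 * (T : ℝ) ≤ n * q ^ 2) (L : Learner n Ω) :
    ∃ θ : Vertex n, (T * n : ℝ) / (32 * q) ≤
      expectedRegret P L (noisePMF M T).toMeasure (noisyAdversary hm T θ) T := by
  by_contra! hlt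
  have hM0 : (0 : ℝ) < M := by exact_mod_cast NeZero.pos M
  have hmq : (M : ℝ) = m * q := by exact_mod_cast hM
  have hm0 : (m : ℝ) ≠ 0 := fun h => hM0.ne' (by rw [hmq, h, zero_mul])
  have hq0 : (q : ℝ) ≠ 0 := fun h => hM0.ne' (by rw [hmq, h, mul_zero])
  have hsum : ∑ θ, expectedRegret P L (noisePMF M T).toMeasure (noisyAdversary hm T θ) T <
      ∑ _θ : Vertex n, (T * n : ℝ) / (32 * q) :=
    Finset.sum_lt_sum_of_nonempty Finset.univ_nonempty fun θ _ => hlt θ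
  have hint := fun θ => integrable_regret P hm T θ L
  have hfub : ∑ θ, expectedRegret P L (noisePMF M T).toMeasure (noisyAdversary hm T θ) T =
      ∫ ω, ∑ θ, ∫ z, regret L (noisyAdversary hm T θ) T ω z ∂(noisePMF M T).toMeasure ∂P := by
    rw [integral_finsetSum _ fun θ _ => (hint θ).integral_prod_left]
    exact Finset.sum_congr rfl fun θ _ => integral_prod _ (hint θ)
  have hpoint : ∀ ω, (2 : ℝ) ^ n * ((T * n : ℝ) / (32 * q)) ≤
      ∑ θ, ∫ z, regret L (noisyAdversary hm T θ) T ω z ∂(noisePMF M T).toMeasure := by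
    intro ω
    simp_rw [integral_regret_noisePMF]
    refine le_trans ?_ (Finset.sum_le_sum fun θ _ =>
      sum_amp_sq_mul_numErr_le_sum_regret hm hdvd θ L ω)
    rw [← Finset.mul_sum, Finset.sum_comm]
    have hb : ∑ _t ∈ Finset.range T, (2 : ℝ) ^ n * n / 8 ≤ ∑ t ∈ Finset.range T,
        ∑ θ : Vertex n, ∑ o, amp (noiseAmp M) (gameShift L m M ω θ) t o ^ 2 *
          numErr θ (play L M ω t o) := by
      refine Finset.sum_le_sum fun t ht => le_sum_amp_sq_mul_numErr hM L ω ?_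
      have : (t : ℝ) ≤ T := by exact_mod_cast (Finset.mem_range.1 ht).le
      linarith
    refine le_trans (le_of_eq ?_) (mul_le_mul_of_nonneg_left hb (by positivity))
    rw [Finset.sum_const, Finset.card_range, nsmul_eq_mul, hmq]
    field_simp
    ring
  have hge : (2 : ℝ) ^ n * ((T * n : ℝ) / (32 * q)) ≤
      ∫ ω, ∑ θ, ∫ z, regret L (noisyAdversary hm T θ) T ω z ∂(noisePMF M T).toMeasure ∂P := by
    refine le_trans (le_of_eq ?_) (integral_mono (integrable_const _)
      (integrable_finsetSum _ fun θ _ => (hint θ).integral_prod_left) hpoint)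
    simp
  rw [hfub] at hsum
  refine lt_irrefl _ (hge.trans_lt (hsum.trans_eq ?_))
  simp

end Expectation

end HypercubeBandit

/-! ### The lower bound -/

open HypercubeBandit in
theorem mainTheorem5 (κ : ℝ) (hκ : 0 < κ) :
    ∃ c : ℝ, 0 < c ∧ ∀ n T : ℕ, κ * (n : ℝ) ≤ (T : ℝ) →
      ∀ (Ω : Type*) [MeasurableSpace Ω] (P : Measure Ω) [IsProbabilityMeasure P]
        (L : HypercubeBandit.Learner n Ω),
        ∃ (Ω' : Type) (_ : MeasurableSpace Ω') (Q : Measure Ω') (_ : IsProbabilityMeasure Q)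
          (A : HypercubeBandit.Adversary n Ω'), A.IsOblivious ∧
          c * (n : ℝ) ^ (3 / 2 : ℝ) * √(T : ℝ) ≤ HypercubeBandit.expectedRegret P L Q A T := by
  have hκ' : 0 < √κ := Real.sqrt_pos.2 hκ
  refine ⟨1 / (32 * (10 + 1 / √κ)), by positivity, ?_⟩
  intro n T hT Ω _ P _ L
  rcases Nat.eq_zero_or_pos n with rfl | hn
  · refine ⟨Unit, inferInstance, Measure.dirac (), inferInstance,
      ⟨fun _ _ _ => 0, fun _ => measurable_const,
        fun _ _ _ => (pi_norm_le_iff_of_nonneg zero_le_one).2 fun i => i.elim0⟩,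
      fun _ _ _ _ => rfl, ?_⟩
    have h : (0 : ℝ) ^ (3 / 2 : ℝ) = 0 := Real.zero_rpow (by norm_num)
    simp [expectedRegret, regret, cost, h]
  have hn' : (0 : ℝ) < n := by exact_mod_cast hn
  have hT' : (0 : ℝ) < T := (by positivity : 0 < κ * n).trans_le hT
  -- The bias is `1 / (4 q)`, and `q ^ 2 ≥ 96 T / n` keeps the information per coordinate small.
  set q := ⌈10 * √(T / n : ℝ)⌉₊
  have hr : 0 < √(T / n : ℝ) := Real.sqrt_pos.2 (by positivity)
  have hq1 : 10 * √(T / n : ℝ) ≤ q := Nat.le_ceil _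
  have hqpos : 0 < q := Nat.ceil_pos.2 (by positivity)
  have hq2 : (q : ℝ) ≤ (10 + 1 / √κ) * √(T / n : ℝ) := by
    -- The rounding error `1` is absorbed by means of `T / n ≥ κ`.
    have h1 : √κ ≤ √(T / n : ℝ) := Real.sqrt_le_sqrt (by rwa [le_div_iff₀ hn'])
    have h2 : 1 ≤ 1 / √κ * √(T / n : ℝ) := by
      rw [one_div_mul_eq_div, le_div_iff₀ hκ', one_mul]
      exact h1
    linarith [Nat.ceil_lt_add_one (by positivity : 0 ≤ 10 * √(T / n : ℝ))]
  have hTq : 96 * (T : ℝ) ≤ n * q ^ 2 := by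
    have h1 : (10 * √(T / n : ℝ)) ^ 2 ≤ (q : ℝ) ^ 2 := pow_le_pow_left₀ (by positivity) hq1 2
    rw [mul_pow, Real.sq_sqrt (by positivity)] at h1
    have h2 : (n : ℝ) * (10 ^ 2 * (T / n)) = 100 * T := by
      field_simp
      norm_num
    linarith [mul_le_mul_of_nonneg_left h1 hn'.le]
  have hMpos : 0 < n.factorial * q := Nat.mul_pos n.factorial_pos hqpos
  have : NeZero (n.factorial * q) := ⟨hMpos.ne'⟩
  obtain ⟨θ, hθ⟩ := exists_le_expectedRegret P (Nat.le_mul_of_pos_right n.factorial hqpos) rfl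
    (fun k hk hkn => Nat.dvd_factorial hk hkn) hTq L
  refine ⟨Noise (n.factorial * q) T, inferInstance, _, inferInstance, _,
    noisyAdversary_isOblivious (Nat.le_mul_of_pos_right n.factorial hqpos) T θ, hθ.trans' ?_⟩
  have hn32 : (n : ℝ) ^ (3 / 2 : ℝ) = n * √n := by
    rw [Real.sqrt_eq_rpow, show (3 / 2 : ℝ) = 1 + 1 / 2 by norm_num, Real.rpow_add hn',
      Real.rpow_one]
  have hroot : √(n : ℝ) * √(T : ℝ) * √(T / n : ℝ) = T := by
    rw [← Real.sqrt_mul hn'.le, ← Real.sqrt_mul (by positivity),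
      show (n : ℝ) * T * (T / n) = T ^ 2 by field_simp, Real.sqrt_sq hT'.le]
  have hq0 : (0 : ℝ) < q := by exact_mod_cast hqpos
  rw [hn32, le_div_iff₀ (by positivity)]
  calc 1 / (32 * (10 + 1 / √κ)) * (n * √n) * √T * (32 * q)
      ≤ 1 / (32 * (10 + 1 / √κ)) * (n * √n) * √T * (32 * ((10 + 1 / √κ) * √(T / n : ℝ))) := by
        gcongr
    _ = n * (√n * √T * √(T / n : ℝ)) := by
        field_simp
    _ = T * n := by rw [hroot, mul_comm]
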